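/- Definitions. Let $\mathbb{C}^{2^{n+c}}=\mathbb{C}^{2^n}\otimes\mathbb{C}^{2^c}$ be the space of $n$ qubits of Alice and $c$ qubits of Bob. An $((n,M,d;c))$ entanglement-assisted (EA) quantum code is an $M$-dimensional subspace $\mathcal{Q}$ of it such that (1) $\mathrm{Tr}_A|\psi\rangle\langle\psi|=2^{-c}\mathbb{I}^B$ for every unit vector $|\psi\rangle\in\mathcal{Q}$, and (2) every error $E\otimes\mathbb{I}^B$, with $E$ a tensor product of $n$ Pauli matrices of which at most $d-1$ are not the identity, is detectable, i.e. $P(E\otimes\mathbb{I}^B)P=\lambda_E P$ for some $\lambda_E\in\mathbb{C}$, where $P$ is the orthogonal projector onto $\mathcal{Q}$. The code is nondegenerate if $B_{i,0}=0$ for all $0<i<d$, where $B_{i,0}=M^{-2}\sum_{\mathrm{wt}(E)=i}\bigl(\mathrm{Tr}\,(E\otimes\mathbb{I}^B)P\bigr)^2$. Let $K_i(x)=K_i(x;n)=\sum_{j=0}^{i}(-1)^j3^{i-j}\binom{x}{j}\binom{n-x}{i-j}$ be the quaternary Krawtchouk polynomials, let $r_t$ be the smallest root of $K_t$ (with $r_0=+\infty$),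 and for an integer $t\ge 0$ and a real $a$ put $$F(x)=\frac{1}{a-x}\bigl(K_{t+1}(x)K_t(a)-K_t(x)K_{t+1}(a)\bigr)^2,\qquad F_l=\frac{1}{4^n}\sum_{x=0}^{n}F(x)K_x(l),$$ so that the $F_l$, $0\le l\le n$, are the Krawtchouk coefficients of $F$ on $\{0,\dots,n\}$. Theorem. Let $d\ge1$, $0\le t\le n-1$, and let $a$ be any real number with $r_{t+1}<a<r_t$ and $a\le d$. (For example, $t$ may be the smallest integer with $r_t<d$; or $t=\lfloor (d-1)/2\rfloor$, whenever $r_{t+1}<d$.) Let $\mathcal{Q}$ be an $((n,M,d;c))$ EA quantum code, degenerate or nondegenerate. 1. If $F_l\neq0$ for all $0\le l\le d-1$, then $$M\le\frac{1}{2^{n-c}}\max_{0\le l\le d-1}\frac{F(l)}{F_l}.$$ 2. If $\mathcal{Q}$ is nondegenerate, then $$M\le\frac{1}{2^{n-c}}\,\frac{\left(3^{t+1}\binom{n}{t+1}K_t(a)-3^t\binom{n}{t}K_{t+1}(a)\right)^2}{a\,F_0}.$$ -/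

import Mathlib

open scoped Kronecker

noncomputable section

namespace EAQuantum

/-- Single-qubit Pauli matrices, indexed by `0, 1, 2, 3` for `I, X, Y, Z`. -/
def pauli : Fin 4 → Matrix (Fin 2) (Fin 2) ℂ :=
  ![!![1, 0; 0, 1], !![0, 1; 1, 0], !![0, -Complex.I; Complex.I, 0], !![1, 0; 0, -1]]

/-- The tensor product `M₁ ⊗ ⋯ ⊗ Mₙ` of Pauli matrices, as a matrix in the computational basis
of the `n`-qubit space.  `Fin n → Fin 4` indexes the phase-free Pauli operators. -/
def pauliString {n : ℕ} (g : Fin n → Fin 4) : Matrix (Fin n → Fin 2) (Fin n → Fin 2) ℂ :=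
  Matrix.of fun u v => ∏ j, pauli (g j) (u j) (v j)

/-- The weight: the number of nonidentity tensor factors. -/
def weight {n : ℕ} (g : Fin n → Fin 4) : ℕ :=
  (Finset.univ.filter fun j => g j ≠ 0).card

/-- The state space of `n + c` qubits, the first `n` held by Alice and the last `c` by Bob. -/
abbrev StateSpace (n c : ℕ) : Type :=
  EuclideanSpace ℂ ((Fin n → Fin 2) × (Fin c → Fin 2))

/-- The operator `E ⊗ F` for a Pauli operator `E` on Alice's and `F` on Bob's qubits. -/
def pauliOp {n c : ℕ} (E : Fin n → Fin 4) (F : Fin c → Fin 4) :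
    StateSpace n c →ₗ[ℂ] StateSpace n c :=
  Matrix.toEuclideanLin (pauliString E ⊗ₖ pauliString F)

/-- The partial trace over the first tensor factor. -/
def partialTraceA {α β : Type} [Fintype α] (ρ : Matrix (α × β) (α × β) ℂ) : Matrix β β ℂ :=
  Matrix.of fun y y' => ∑ x, ρ (x, y) (x, y')

/-- The matrix of `|ψ⟩⟨ψ|`. -/
def ketBra {n c : ℕ} (ψ : StateSpace n c) :
    Matrix ((Fin n → Fin 2) × (Fin c → Fin 2)) ((Fin n → Fin 2) × (Fin c → Fin 2)) ℂ :=
  Matrix.of fun i j => ψ i * star (ψ j)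

/-- An error operator is detectable by the code `Q` if `⟨v|E|w⟩ = λ ⟨v|w⟩` on `Q` for a constant
`λ` depending only on `E` (equivalently `P E P = λ P`). -/
def Detectable {n c : ℕ} (Q : Submodule ℂ (StateSpace n c))
    (E : StateSpace n c →ₗ[ℂ] StateSpace n c) : Prop :=
  ∃ lam : ℂ, ∀ v ∈ Q, ∀ w ∈ Q, inner ℂ v (E w) = lam * inner ℂ v w

/-- `Q` is an `((n, M, d; c))` entanglement-assisted quantum code. -/
structure IsEACode (n M d c : ℕ) (Q : Submodule ℂ (StateSpace n c)) : Prop where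
  dim : Module.finrank ℂ Q = M
  bob_maximally_mixed : ∀ ψ ∈ Q, ‖ψ‖ = 1 →
    partialTraceA (ketBra ψ) = ((1 : ℂ) / 2 ^ c) • (1 : Matrix (Fin c → Fin 2) (Fin c → Fin 2) ℂ)
  detects : ∀ E : Fin n → Fin 4, weight E + 1 ≤ d → Detectable Q (pauliOp E 0)

/-- The split weight enumerator
`B i j = M⁻² ∑ |Tr ((E ⊗ F) P)|²` over Pauli operators `E`, `F` of weights `i`, `j`, where `P` is
the orthogonal projector onto `Q` and `M = dim Q` (the traces are real). -/
def splitB {n c : ℕ} (Q : Submodule ℂ (StateSpace n c)) (i j : ℕ) : ℝ :=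
  1 / (Module.finrank ℂ Q : ℝ) ^ 2 *
    ∑ E ∈ Finset.univ.filter (fun E : Fin n → Fin 4 => weight E = i),
      ∑ F ∈ Finset.univ.filter (fun F : Fin c → Fin 4 => weight F = j),
        ‖LinearMap.trace ℂ (StateSpace n c)
          (pauliOp E F ∘ₗ (Q.starProjection : StateSpace n c →ₗ[ℂ] StateSpace n c))‖ ^ 2

/-- A code of minimum distance `d` is degenerate if `B i 0 > 0` for some `0 < i < d`. -/
def Degenerate {n c : ℕ} (Q : Submodule ℂ (StateSpace n c)) (d : ℕ) : Prop :=
  ∃ i : ℕ, 0 < i ∧ i < d ∧ 0 < splitB Q i 0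

/-- The quaternary Krawtchouk polynomial `K_i(x; n)`; `Ring.choose x j` is the generalized
binomial coefficient `x (x - 1) ⋯ (x - j + 1) / j!`. -/
def krawtchouk (n i : ℕ) (x : ℝ) : ℝ :=
  ∑ j ∈ Finset.range (i + 1),
    (-1) ^ j * 3 ^ (i - j) * Ring.choose x j * Ring.choose ((n : ℝ) - x) (i - j)

/-- The smallest real root `r_t` of `K_t(x; n)`, as an extended real (so that `r_0 = ⊤`). -/
def smallestRoot (n t : ℕ) : EReal :=
  sInf ((fun x : ℝ => (x : EReal)) '' {x : ℝ | krawtchouk n t x = 0})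

/-- The values of the polynomial
`F(x) = (K_{t+1}(x) K_t(a) - K_t(x) K_{t+1}(a))² / (a - x)`.  The numerator has a double zero at
`x = a`, so the value `0` that the formula gives there is the value of the polynomial. -/
def lpPoly (n t : ℕ) (a x : ℝ) : ℝ :=
  (krawtchouk n (t + 1) x * krawtchouk n t a - krawtchouk n t x * krawtchouk n (t + 1) a) ^ 2
    / (a - x)

/-- The Krawtchouk coefficients `F_l = 4⁻ⁿ ∑ₓ F(x) K_x(l; n)`, that is
`F(x) = ∑_l F_l K_l(x; n)` for `x = 0, …, n`. -/
def lpCoeff (n t : ℕ) (a : ℝ) (l : ℕ) : ℝ :=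
  1 / 4 ^ n * ∑ x ∈ Finset.range (n + 1), lpPoly n t a x * krawtchouk n x l

end EAQuantum

end

/-! ### Krawtchouk polynomials: recurrence, smallest roots, Christoffel–Darboux -/

namespace EAQuantum

/-! This is a linear programming bound. For Pauli strings put T(E,G) = Tr((E⊗G)P), S(E) = ∑_G
T(E,G)² and D(H) = Tr((H⊗I)P(H⊗I)P) ≥ 0. The MacWilliams identity says that the commutation-sign
transform of S is 2^(n+c) D; paired with F it gives 4^n ∑_E F_{wt E} S(E) = 2^(n+c) ∑_H F(wt H)
D(H). On the left F_l ≥ 0, so only weights below d and the term G = I need be kept. On the right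
F(x) ≤ 0 for x ≥ a, hence for weights at least d. Below d, detectability gives M·D(E) = T(E,I)².
Both sides then involve the same numbers T(E,I)² (`lp_inequality`), and the two bounds follow by
comparing F(l) with F_l, or by keeping only E = I. Nonnegativity of F_l (`lpCoeff_nonneg`): by
Christoffel–Darboux, F is a combination of the products K_{t+1}K_i and K_tK_i, i ≤ t, with positive
coefficients, because K_i(a) > 0 > K_{t+1}(a) for r_{t+1} < a < r_t. Such products have nonnegative
Krawtchouk coefficients, since K_i is a sum of characters. -/

theorem ringChoose_succ_mul (r : ℝ) (k : ℕ) :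
    Ring.choose r (k + 1) * (k + 1) = Ring.choose r k * (r - k) := by
  rw [Ring.choose_eq_smul, Ring.choose_eq_smul, descPochhammer_succ_right,
    Polynomial.smeval_mul, Nat.factorial_succ]
  have h : (Polynomial.X - (k : Polynomial ℤ)).smeval r = r - k := by
    rw [Polynomial.smeval_sub, Polynomial.smeval_X, pow_one, Polynomial.smeval_natCast]
    simp
  have hk : ((k : ℝ) + 1) ≠ 0 := by positivity
  have hf : ((k.factorial : ℕ) : ℝ) ≠ 0 := by positivity
  rw [h]
  simp only [smul_eq_mul]
  push_cast
  field_simp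

theorem ringChoose_pos {r : ℝ} {k : ℕ} (h : (k : ℝ) - 1 < r) : 0 < Ring.choose r k := by
  induction k with
  | zero => simp
  | succ k ih =>
    push_cast at h
    have h1 : 0 < Ring.choose r k * (r - k) := mul_pos (ih (by linarith)) (by linarith)
    rw [← ringChoose_succ_mul] at h1
    exact pos_of_mul_pos_left h1 (by positivity)

theorem neg_one_pow_mul_ringChoose_nonneg {r : ℝ} (h : r ≤ 0) (k : ℕ) :
    0 ≤ (-1) ^ k * Ring.choose r k := by
  induction k with
  | zero => simp
  | succ k ih =>
    have h1 : 0 ≤ ((-1) ^ k * Ring.choose r k) * (k - r) :=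
      mul_nonneg ih (by have : (0 : ℝ) ≤ k := k.cast_nonneg; linarith)
    have h2 : ((-1) ^ k * Ring.choose r k) * (k - r)
        = ((-1) ^ (k + 1) * Ring.choose r (k + 1)) * (k + 1) := by
      rw [mul_assoc ((-1 : ℝ) ^ (k + 1)), ringChoose_succ_mul]; ring
    rw [h2] at h1
    exact nonneg_of_mul_nonneg_left h1 (by positivity)

/-- The generating series `(1 - z) ^ x * (1 + 3 z) ^ (n - x)`. -/
noncomputable def krawtchoukSeries (n : ℕ) (x : ℝ) : PowerSeries ℝ :=
  PowerSeries.mk (fun j => (-1) ^ j * Ring.choose x j) *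
    PowerSeries.mk (fun k => 3 ^ k * Ring.choose ((n : ℝ) - x) k)

theorem coeff_krawtchoukSeries (n i : ℕ) (x : ℝ) :
    PowerSeries.coeff i (krawtchoukSeries n x) = krawtchouk n i x := by
  rw [krawtchoukSeries, PowerSeries.coeff_mul, krawtchouk,
    Finset.Nat.sum_antidiagonal_eq_sum_range_succ_mk]
  refine Finset.sum_congr rfl fun j _ => ?_
  simp only [PowerSeries.coeff_mk]
  ring

/-- The differential equation of (1 + bz)^r for real r; coefficientwise it is `ringChoose_succ_mul`.
-/
theorem one_add_mul_derivative_mk_ringChoose (b r : ℝ) :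
    (1 + PowerSeries.C b * PowerSeries.X) *
      PowerSeries.derivative ℝ (PowerSeries.mk fun j => b ^ j * Ring.choose r j)
      = PowerSeries.C (b * r) * PowerSeries.mk fun j => b ^ j * Ring.choose r j := by
  ext k
  rw [add_mul, one_mul, map_add, mul_assoc, PowerSeries.coeff_C_mul, PowerSeries.coeff_C_mul,
    PowerSeries.coeff_derivative, PowerSeries.coeff_mk, PowerSeries.coeff_mk, mul_assoc,
    ringChoose_succ_mul]
  cases k with
  | zero => simp
  | succ k =>
    rw [PowerSeries.coeff_succ_X_mul, PowerSeries.coeff_derivative, PowerSeries.coeff_mk]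
    push_cast
    ring

/-- Logarithmic derivative of the product, cleared of the denominator (1 - z)(1 + 3z). Its
coefficients are the three-term recurrence. -/
theorem krawtchoukSeries_derivative (n : ℕ) (x : ℝ) :
    (1 + PowerSeries.C 2 * PowerSeries.X - PowerSeries.C 3 * PowerSeries.X ^ 2) *
        PowerSeries.derivative ℝ (krawtchoukSeries n x)
      = (PowerSeries.C (3 * n - 4 * x) - PowerSeries.C (3 * (n : ℝ)) * PowerSeries.X) *
        krawtchoukSeries n x := by
  have hU := one_add_mul_derivative_mk_ringChoose (-1) x
  have hV := one_add_mul_derivative_mk_ringChoose 3 ((n : ℝ) - x)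
  rw [krawtchoukSeries, Derivation.leibniz]
  set U := PowerSeries.mk fun j => (-1) ^ j * Ring.choose x j
  set V := PowerSeries.mk fun k => 3 ^ k * Ring.choose ((n : ℝ) - x) k
  simp only [map_sub, map_mul, map_neg, map_one, map_ofNat, map_natCast, smul_eq_mul] at *
  linear_combination (1 + 3 * PowerSeries.X) * V * hU + (1 - PowerSeries.X) * U * hV

theorem krawtchouk_zero (n : ℕ) (x : ℝ) : krawtchouk n 0 x = 1 := by
  simp [krawtchouk]

theorem krawtchouk_one (n : ℕ) (x : ℝ) : krawtchouk n 1 x = 3 * n - 4 * x := by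
  simp [krawtchouk, Finset.sum_range_succ]
  ring

theorem krawtchouk_succ_succ (n i : ℕ) (x : ℝ) :
    (i + 2) * krawtchouk n (i + 2) x
      = (3 * n - 4 * x - 2 * (i + 1)) * krawtchouk n (i + 1) x
        - 3 * (n - i) * krawtchouk n i x := by
  have h := congrArg (PowerSeries.coeff (i + 1)) (krawtchoukSeries_derivative n x)
  rw [sub_mul, sub_mul, add_mul, one_mul, map_sub, map_sub, map_add, mul_assoc, mul_assoc,
    mul_assoc] at h
  simp only [PowerSeries.coeff_C_mul, PowerSeries.coeff_succ_X_mul, PowerSeries.coeff_derivative,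
    coeff_krawtchoukSeries, pow_two, mul_assoc] at h
  have h2 : PowerSeries.coeff i
      (PowerSeries.X * PowerSeries.derivative ℝ (krawtchoukSeries n x))
        = i * krawtchouk n i x := by
    cases i with
    | zero => simp
    | succ k =>
      rw [PowerSeries.coeff_succ_X_mul, PowerSeries.coeff_derivative, coeff_krawtchoukSeries]
      push_cast; ring
  rw [h2] at h
  push_cast at h
  rw [show i + 1 + 1 = i + 2 from rfl] at h
  linear_combination h

theorem continuous_krawtchouk (n i : ℕ) : Continuous (krawtchouk n i) := by
  induction i using Nat.twoStepInduction with
  | zero => simp only [funext (krawtchouk_zero n)]; fun_prop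
  | one => simp only [funext (krawtchouk_one n)]; fun_prop
  | more i h0 h1 =>
    have : krawtchouk n (i + 2) = fun x => ((3 * n - 4 * x - 2 * (i + 1)) * krawtchouk n (i + 1) x
        - 3 * (n - i) * krawtchouk n i x) / (i + 2) := by
      funext x
      rw [← krawtchouk_succ_succ]
      field_simp
    rw [this]
    fun_prop

/-- No summand is negative, as (-1)^j binom(x, j) ≥ 0 for x ≤ 0, and the summand j = 0 is positive.
-/
theorem krawtchouk_pos_of_nonpos {n i : ℕ} (hi : i ≤ n) {x : ℝ} (hx : x ≤ 0) :
    0 < krawtchouk n i x := by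
  rw [krawtchouk, Finset.sum_range_succ']
  have hin : (i : ℝ) ≤ n := by exact_mod_cast hi
  refine add_pos_of_nonneg_of_pos (Finset.sum_nonneg fun j hj => ?_) ?_
  · rw [mul_right_comm ((-1 : ℝ) ^ _)]
    refine mul_nonneg (mul_nonneg (neg_one_pow_mul_ringChoose_nonneg hx _) (by positivity))
      (ringChoose_pos ?_).le
    have : ((i - (j + 1) : ℕ) : ℝ) ≤ i := by exact_mod_cast Nat.sub_le _ _
    linarith
  · have := ringChoose_pos (r := (n : ℝ) - x) (k := i) (by linarith)
    simp only [pow_zero, one_mul, Ring.choose_zero_right, mul_one, Nat.sub_zero]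
    positivity

theorem krawtchouk_at_zero (n i : ℕ) : krawtchouk n i 0 = 3 ^ i * (n.choose i : ℝ) := by
  rw [krawtchouk, Finset.sum_range_succ', Finset.sum_eq_zero]
  · simp [Ring.choose_natCast]
  · intro j _
    simp [Ring.choose_zero_succ]

/-- The Christoffel–Darboux formula, with unspecified positive coefficients. -/
theorem exists_christoffelDarboux {n t : ℕ} (ht : t ≤ n) :
    ∃ c : ℕ → ℝ, (∀ i, 0 < c i) ∧ ∀ x y : ℝ,
      krawtchouk n (t + 1) x * krawtchouk n t y - krawtchouk n t x * krawtchouk n (t + 1) y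
        = (y - x) * ∑ i ∈ Finset.range (t + 1), c i * (krawtchouk n i x * krawtchouk n i y) := by
  induction t with
  | zero =>
    refine ⟨fun _ => 4, fun _ => by norm_num, fun x y => ?_⟩
    simp [krawtchouk_zero, krawtchouk_one]
    ring
  | succ t ih =>
    obtain ⟨c, hc, h⟩ := ih (by omega)
    have htn : (t : ℝ) + 1 ≤ n := by exact_mod_cast ht
    -- One use of the recurrence rescales the old kernel by 3(n - t)/(t + 2), positive since t < n;
    -- the new term comes from the slope -4 in x.
    refine ⟨fun i => if i = t + 1 then 4 / (t + 2) else 3 * (n - t) / (t + 2) * c i,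
      fun i => ?_, fun x y => ?_⟩
    · have := hc i
      have : (0 : ℝ) < n - t := by linarith
      dsimp only
      split_ifs <;> positivity
    · rw [Finset.sum_range_succ]
      dsimp only
      rw [if_pos rfl]
      have hs : ∑ i ∈ Finset.range (t + 1),
          (if i = t + 1 then 4 / ((t : ℝ) + 2) else 3 * (n - t) / (t + 2) * c i) *
            (krawtchouk n i x * krawtchouk n i y)
          = 3 * (n - t) / (t + 2) *
            ∑ i ∈ Finset.range (t + 1), c i * (krawtchouk n i x * krawtchouk n i y) := by
        rw [Finset.mul_sum]
        refine Finset.sum_congr rfl fun i hi => ?_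
        rw [if_neg (by have := Finset.mem_range.1 hi; omega)]
        ring
      rw [hs, mul_add, mul_left_comm, ← h]
      have hx := krawtchouk_succ_succ n t x
      have hy := krawtchouk_succ_succ n t y
      have h2 : ((t : ℝ) + 2) ≠ 0 := by positivity
      rw [show t + 1 + 1 = t + 2 from rfl]
      field_simp
      linear_combination krawtchouk n (t + 1) y * hx - krawtchouk n (t + 1) x * hy

theorem exists_smallest_zero {f : ℝ → ℝ} (hf : Continuous f) {b s : ℝ}
    (hb : ∀ y ≤ b, 0 < f y) (hs : f s < 0) :
    ∃ r < s, f r = 0 ∧ ∀ y < r, 0 < f y := by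
  set S := {y | f y ≤ 0}
  have hS : IsClosed S := isClosed_le hf continuous_const
  have hbd : BddBelow S := ⟨b, fun y hy => le_of_not_ge fun h => (hb y h).not_ge hy⟩
  have hmem : sInf S ∈ S := hS.csInf_mem ⟨s, hs.le⟩ hbd
  have hpos : ∀ y < sInf S, 0 < f y := fun y hy => lt_of_not_ge fun h => notMem_of_lt_csInf hy hbd h
  have h0 : 0 ≤ f (sInf S) := by
    refine ge_of_tendsto (hf.continuousAt.tendsto.mono_left nhdsWithin_le_nhds)
      (Filter.eventually_of_mem (self_mem_nhdsWithin (s := Set.Iio (sInf S)))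
        fun y hy => (hpos y hy).le)
  have hz : f (sInf S) = 0 := le_antisymm hmem h0
  refine ⟨sInf S, lt_of_le_of_ne (csInf_le hbd hs.le) ?_, hz, hpos⟩
  rintro h
  rw [h] at hz
  exact hs.ne hz

/-- At the smallest zero s of K_{i+1} the recurrence leaves (i+2)K_{i+2}(s) = -3(n-i)K_i(s) < 0, so
K_{i+2} has its smallest zero left of s, where all lower polynomials are positive. -/
theorem exists_krawtchouk_smallest_zero {n i : ℕ} (hi : i + 1 ≤ n) :
    ∃ r : ℝ, krawtchouk n (i + 1) r = 0 ∧ (∀ y < r, 0 < krawtchouk n (i + 1) y) ∧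
      ∀ j ≤ i, ∀ y ≤ r, 0 < krawtchouk n j y := by
  induction i with
  | zero =>
    refine ⟨3 * n / 4, ?_, fun y hy => ?_, fun j hj y _ => ?_⟩
    · rw [krawtchouk_one]; ring
    · rw [krawtchouk_one]; linarith
    · rw [Nat.le_zero.1 hj, krawtchouk_zero]; exact one_pos
  | succ i ih =>
    obtain ⟨s, hs, hs1, hs2⟩ := ih (by omega)
    have hrec := krawtchouk_succ_succ n i s
    rw [hs, mul_zero, zero_sub] at hrec
    have hin : (0 : ℝ) < n - i := by
      have : (i : ℝ) + 1 + 1 ≤ n := by exact_mod_cast hi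
      linarith
    have hneg : krawtchouk n (i + 2) s < 0 := by
      have h1 : 0 < 3 * ((n : ℝ) - i) * krawtchouk n i s :=
        mul_pos (by linarith) (hs2 i le_rfl s le_rfl)
      have h2 : (0 : ℝ) < (i : ℝ) + 2 := by positivity
      by_contra! h
      nlinarith [mul_nonneg h2.le h]
    obtain ⟨r, hrs, hr, hr1⟩ := exists_smallest_zero (continuous_krawtchouk n (i + 2)) (b := 0)
      (fun y hy => krawtchouk_pos_of_nonpos (by omega) hy) hneg
    refine ⟨r, hr, hr1, fun j hj y hy => ?_⟩
    rcases Nat.le_succ_iff.1 hj with h | rfl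
    · exact hs2 j h y (by linarith)
    · exact hs1 y (by linarith)

theorem krawtchouk_pos_of_lt_smallestRoot {n t : ℕ} (ht : t ≤ n) {a : ℝ}
    (ha : (a : EReal) < smallestRoot n t) {j : ℕ} (hj : j ≤ t) {y : ℝ} (hy : y ≤ a) :
    0 < krawtchouk n j y := by
  cases t with
  | zero => rw [Nat.le_zero.1 hj, krawtchouk_zero]; exact one_pos
  | succ t =>
    obtain ⟨r, hr, hr1, hr2⟩ := exists_krawtchouk_smallest_zero ht
    have har : a < r := by
      have : smallestRoot n (t + 1) ≤ (r : EReal) := sInf_le ⟨r, hr, rfl⟩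
      exact_mod_cast ha.trans_le this
    rcases Nat.le_succ_iff.1 hj with h | rfl
    · exact hr2 j h y (by linarith)
    · exact hr1 y (by linarith)

theorem pos_of_smallestRoot_lt {n t : ℕ} (ht : t ≤ n) {a : ℝ}
    (ha : smallestRoot n t < (a : EReal)) : 0 < a := by
  obtain ⟨_, ⟨r, hr, rfl⟩, hra⟩ := sInf_lt_iff.1 ha
  have hra' : r < a := EReal.coe_lt_coe_iff.1 hra
  have : 0 < r := by
    by_contra! h
    exact (krawtchouk_pos_of_nonpos ht h).ne' hr
  linarith

/-- Christoffel–Darboux at a and a root r < a of K_{t+1} reads -K_t(r)K_{t+1}(a) = (a - r) ·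
(positive sum). -/
theorem krawtchouk_succ_neg {n t : ℕ} (ht : t + 1 ≤ n) {a : ℝ}
    (hr₁ : smallestRoot n (t + 1) < (a : EReal)) (hr₀ : (a : EReal) < smallestRoot n t) :
    krawtchouk n (t + 1) a < 0 := by
  obtain ⟨_, ⟨r, hr, rfl⟩, hra⟩ := sInf_lt_iff.1 hr₁
  have hra' : r < a := EReal.coe_lt_coe_iff.1 hra
  have hr' : krawtchouk n (t + 1) r = 0 := hr
  have hpos : ∀ j ≤ t, ∀ y ≤ a, 0 < krawtchouk n j y := fun j hj y hy =>
    krawtchouk_pos_of_lt_smallestRoot (by omega) hr₀ hj hy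
  obtain ⟨c, hc, h⟩ := exists_christoffelDarboux (n := n) (t := t) (by omega)
  have h := h r a
  have hsum : 0 < ∑ i ∈ Finset.range (t + 1), c i * (krawtchouk n i r * krawtchouk n i a) := by
    refine Finset.sum_pos (fun i hi => ?_) ⟨0, by simp⟩
    have hi := Nat.lt_succ_iff.1 (Finset.mem_range.1 hi)
    exact mul_pos (hc i) (mul_pos (hpos i hi r hra'.le) (hpos i hi a le_rfl))
  rw [hr', zero_mul, zero_sub] at h
  have h1 := mul_pos (sub_pos.2 hra') hsum
  rw [← h, ← mul_neg] at h1
  have := pos_of_mul_pos_right h1 (hpos t le_rfl r hra'.le).le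
  linarith

/-- The polynomial `F` as a combination of products of Krawtchouk polynomials. -/
theorem exists_lpPoly_eq {n t : ℕ} (ht : t ≤ n) :
    ∃ c : ℕ → ℝ, (∀ i, 0 < c i) ∧ ∀ a x : ℝ, lpPoly n t a x =
      ∑ i ∈ Finset.range (t + 1), c i * krawtchouk n i a *
        (krawtchouk n t a * (krawtchouk n (t + 1) x * krawtchouk n i x)
          + -krawtchouk n (t + 1) a * (krawtchouk n t x * krawtchouk n i x)) := by
  obtain ⟨c, hc, h⟩ := exists_christoffelDarboux ht
  refine ⟨c, hc, fun a x => ?_⟩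
  have hR : ∑ i ∈ Finset.range (t + 1), c i * krawtchouk n i a *
        (krawtchouk n t a * (krawtchouk n (t + 1) x * krawtchouk n i x)
          + -krawtchouk n (t + 1) a * (krawtchouk n t x * krawtchouk n i x))
      = (krawtchouk n (t + 1) x * krawtchouk n t a - krawtchouk n t x * krawtchouk n (t + 1) a) *
        ∑ i ∈ Finset.range (t + 1), c i * (krawtchouk n i x * krawtchouk n i a) := by
    rw [Finset.mul_sum]
    exact Finset.sum_congr rfl fun i _ => by ring
  rw [hR, lpPoly, h]
  -- At x = a both sides vanish: the left by division by zero, the right by the factor a - x.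
  by_cases hax : a - x = 0
  · simp [hax]
  · field_simp

end EAQuantum

/-! ### Commutation characters and nonnegativity of the coefficients F_l -/

namespace EAQuantum

/-- The sign by which two single-qubit Pauli matrices commute. -/
def pauliSign (g h : Fin 4) : ℝ := if g = 0 ∨ h = 0 ∨ g = h then 1 else -1

/-- The sign by which two Pauli strings commute. -/
noncomputable def pauliChar {n : ℕ} (E H : Fin n → Fin 4) : ℝ := ∏ j, pauliSign (E j) (H j)

theorem pauliChar_comm {n : ℕ} (E H : Fin n → Fin 4) : pauliChar E H = pauliChar H E := by
  refine Finset.prod_congr rfl fun j _ => ?_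
  simp only [pauliSign, eq_comm (a := E j) (b := H j), or_left_comm]

theorem weight_le {n : ℕ} (E : Fin n → Fin 4) : weight E ≤ n :=
  (Finset.card_filter_le _ _).trans (by simp)

theorem exists_weight_eq {n l : ℕ} (hl : l ≤ n) : ∃ E : Fin n → Fin 4, weight E = l := by
  obtain ⟨s, -, hs⟩ := Finset.exists_subset_card_eq (s := (Finset.univ : Finset (Fin n)))
    (n := l) (by simpa using hl)
  refine ⟨fun j => if j ∈ s then 1 else 0, ?_⟩
  rw [weight, ← hs]
  congr 1
  ext j
  by_cases hj : j ∈ s <;> simp [hj]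

theorem weight_eq_zero_iff {n : ℕ} (E : Fin n → Fin 4) : weight E = 0 ↔ E = 0 := by
  rw [weight, Finset.card_eq_zero, Finset.filter_eq_empty_iff]
  simp [funext_iff]

theorem mk_pow_mul_ringChoose_natCast (b : ℝ) (m : ℕ) :
    (PowerSeries.mk fun j => b ^ j * Ring.choose (m : ℝ) j)
      = (1 + PowerSeries.C b * PowerSeries.X) ^ m := by
  have h := congrArg (PowerSeries.rescale b) (PowerSeries.binomialSeries_nat (R := ℝ) (A := ℝ) m)
  rw [map_pow, map_add, map_one, PowerSeries.rescale_X] at h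
  rw [← h]
  ext j
  rw [PowerSeries.coeff_rescale, PowerSeries.binomialSeries_coeff, PowerSeries.coeff_mk, smul_eq_mul,
    mul_one]

theorem sum_pauliSign_pow (h : Fin 4) :
    ∑ g : Fin 4, PowerSeries.C (pauliSign g h) * PowerSeries.X ^ (if g ≠ 0 then 1 else 0)
      = if h ≠ 0 then 1 + PowerSeries.C (-1 : ℝ) * PowerSeries.X
        else 1 + PowerSeries.C 3 * PowerSeries.X := by
  fin_cases h <;> simp [Fin.sum_univ_four, pauliSign]
  ring_nf
  rw [map_ofNat]

/-- Sign and weight factor over the qubits: each qubit in the support of H contributes 1 - z, every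
other one 1 + 3z. -/
theorem sum_pauliChar_pow {n : ℕ} (H : Fin n → Fin 4) :
    ∑ E : Fin n → Fin 4, PowerSeries.C (pauliChar E H) * PowerSeries.X ^ weight E
      = krawtchoukSeries n (weight H) := by
  have h1 : ∀ E : Fin n → Fin 4, PowerSeries.C (pauliChar E H) * PowerSeries.X ^ weight E
      = ∏ j, (PowerSeries.C (pauliSign (E j) (H j)) *
        PowerSeries.X ^ (if E j ≠ 0 then 1 else 0)) := by
    intro E
    rw [Finset.prod_mul_distrib, Finset.prod_pow_eq_pow_sum, ← map_prod, weight,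
      Finset.card_filter]
    rfl
  have h2 : (n : ℝ) - weight H = ((Finset.univ.filter fun j => ¬ H j ≠ 0).card : ℕ) := by
    have := Finset.card_filter_add_card_filter_not (s := Finset.univ) (fun j => H j ≠ 0)
    rw [Finset.card_univ, Fintype.card_fin] at this
    rw [weight, sub_eq_iff_eq_add]
    exact_mod_cast (this.symm.trans (add_comm _ _))
  simp_rw [h1]
  rw [← Fintype.prod_sum (fun j g => PowerSeries.C (pauliSign g (H j)) *
    PowerSeries.X ^ (if g ≠ 0 then 1 else 0))]
  simp_rw [sum_pauliSign_pow]
  rw [Finset.prod_ite, Finset.prod_const, Finset.prod_const, krawtchoukSeries, h2,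
    mk_pow_mul_ringChoose_natCast, mk_pow_mul_ringChoose_natCast]
  rfl

theorem sum_pauliChar_weight_eq {n : ℕ} (i : ℕ) (H : Fin n → Fin 4) :
    ∑ E ∈ Finset.univ.filter (fun E : Fin n → Fin 4 => weight E = i), pauliChar E H
      = krawtchouk n i (weight H) := by
  rw [← coeff_krawtchoukSeries, ← sum_pauliChar_pow, map_sum, Finset.sum_filter]
  refine Finset.sum_congr rfl fun E _ => ?_
  rw [PowerSeries.coeff_C_mul, PowerSeries.coeff_X_pow]
  simp [eq_comm]

theorem sum_mul_krawtchouk_weight {n : ℕ} (f : ℕ → ℝ) (L : Fin n → Fin 4) :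
    ∑ x ∈ Finset.range (n + 1), f x * krawtchouk n x (weight L)
      = ∑ E, f (weight E) * pauliChar E L := by
  rw [← Finset.sum_fiberwise_of_maps_to (s := Finset.univ) (t := Finset.range (n + 1))
    (g := weight) (fun E _ => Finset.mem_range.2 (Nat.lt_succ_of_le (weight_le E)))]
  refine Finset.sum_congr rfl fun x _ => ?_
  rw [← sum_pauliChar_weight_eq, Finset.mul_sum]
  refine Finset.sum_congr rfl fun E hE => ?_
  rw [(Finset.mem_filter.1 hE).2]

/-- The signs are characters of the Klein four-group, so the sum is 4 or 0. -/
theorem sum_pauliSign_triple_nonneg (a b l : Fin 4) :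
    0 ≤ ∑ g, pauliSign a g * pauliSign b g * pauliSign g l := by
  fin_cases a <;> fin_cases b <;> fin_cases l <;> simp [Fin.sum_univ_four, pauliSign] <;> norm_num

theorem sum_pauliChar_triple {n : ℕ} (A B L : Fin n → Fin 4) :
    ∑ E, pauliChar A E * pauliChar B E * pauliChar E L
      = ∏ j, ∑ g, pauliSign (A j) g * pauliSign (B j) g * pauliSign g (L j) := by
  rw [Fintype.prod_sum]
  simp only [pauliChar, Finset.prod_mul_distrib]

theorem sum_pauliChar_triple_nonneg {n : ℕ} (A B L : Fin n → Fin 4) :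
    0 ≤ ∑ E, pauliChar A E * pauliChar B E * pauliChar E L := by
  rw [sum_pauliChar_triple]
  exact Finset.prod_nonneg fun j _ => sum_pauliSign_triple_nonneg _ _ _

theorem sum_pauliChar_triple_self_pos {n : ℕ} (A : Fin n → Fin 4) :
    0 < ∑ E, pauliChar A E * pauliChar A E * pauliChar E 0 := by
  rw [sum_pauliChar_triple]
  refine Finset.prod_pos fun j _ => ?_
  generalize A j = a
  fin_cases a <;> simp [Fin.sum_univ_four, pauliSign] <;> norm_num

theorem sum_krawtchouk_triple {n : ℕ} (i j : ℕ) (L : Fin n → Fin 4) :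
    ∑ x ∈ Finset.range (n + 1), krawtchouk n i x * krawtchouk n j x * krawtchouk n x (weight L)
      = ∑ A ∈ Finset.univ.filter (fun A : Fin n → Fin 4 => weight A = i),
          ∑ B ∈ Finset.univ.filter (fun B : Fin n → Fin 4 => weight B = j),
            ∑ E, pauliChar A E * pauliChar B E * pauliChar E L := by
  rw [sum_mul_krawtchouk_weight (fun x => krawtchouk n i x * krawtchouk n j x)]
  simp only [← sum_pauliChar_weight_eq, Finset.sum_mul]
  rw [Finset.sum_comm]
  refine Finset.sum_congr rfl fun A _ => ?_
  rw [Finset.sum_comm]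
  simp only [Finset.mul_sum, Finset.sum_mul]

theorem sum_krawtchouk_triple_nonneg {n l : ℕ} (hl : l ≤ n) (i j : ℕ) :
    0 ≤ ∑ x ∈ Finset.range (n + 1),
      krawtchouk n i x * krawtchouk n j x * krawtchouk n x l := by
  obtain ⟨L, rfl⟩ := exists_weight_eq hl
  rw [sum_krawtchouk_triple]
  exact Finset.sum_nonneg fun A _ => Finset.sum_nonneg fun B _ => sum_pauliChar_triple_nonneg _ _ _

theorem sum_krawtchouk_sq_pos {n i : ℕ} (hi : i ≤ n) :
    0 < ∑ x ∈ Finset.range (n + 1),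
      krawtchouk n i x * krawtchouk n i x * krawtchouk n x (0 : ℕ) := by
  obtain ⟨A, hA⟩ := exists_weight_eq hi
  have h0 : weight (0 : Fin n → Fin 4) = 0 := (weight_eq_zero_iff _).2 rfl
  have hA' : A ∈ Finset.univ.filter (fun A : Fin n → Fin 4 => weight A = i) := by simp [hA]
  rw [← h0, sum_krawtchouk_triple]
  refine Finset.sum_pos' (fun A _ => Finset.sum_nonneg fun B _ => sum_pauliChar_triple_nonneg _ _ _)
    ⟨A, hA', Finset.sum_pos' (fun B _ => sum_pauliChar_triple_nonneg _ _ _) ⟨A, hA', ?_⟩⟩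
  exact sum_pauliChar_triple_self_pos A

section lpCoeff

variable {n t : ℕ} {a : ℝ}

theorem exists_lpCoeff_eq (ht : t ≤ n) (a : ℝ) :
    ∃ c : ℕ → ℝ, (∀ i, 0 < c i) ∧ ∀ l : ℕ, lpCoeff n t a l =
      1 / 4 ^ n * ∑ i ∈ Finset.range (t + 1), c i * krawtchouk n i a *
        (krawtchouk n t a * ∑ x ∈ Finset.range (n + 1),
            krawtchouk n (t + 1) x * krawtchouk n i x * krawtchouk n x l
          + -krawtchouk n (t + 1) a * ∑ x ∈ Finset.range (n + 1),
            krawtchouk n t x * krawtchouk n i x * krawtchouk n x l) := by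
  obtain ⟨c, hc, h⟩ := exists_lpPoly_eq ht
  refine ⟨c, hc, fun l => ?_⟩
  rw [lpCoeff]
  simp only [h, Finset.sum_mul, Finset.mul_sum, ← Finset.sum_add_distrib]
  rw [Finset.sum_comm]
  refine Finset.sum_congr rfl fun i _ => Finset.sum_congr rfl fun x _ => ?_
  ring

theorem lpCoeff_nonneg (ht : t + 1 ≤ n) (hr₁ : smallestRoot n (t + 1) < (a : EReal))
    (hr₀ : (a : EReal) < smallestRoot n t) {l : ℕ} (hl : l ≤ n) : 0 ≤ lpCoeff n t a l := by
  obtain ⟨c, hc, h⟩ := exists_lpCoeff_eq (n := n) (t := t) (by omega) a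
  have hneg := krawtchouk_succ_neg ht hr₁ hr₀
  have hpos : ∀ j ≤ t, 0 < krawtchouk n j a := fun j hj =>
    krawtchouk_pos_of_lt_smallestRoot (by omega) hr₀ hj le_rfl
  rw [h]
  refine mul_nonneg (by positivity) (Finset.sum_nonneg fun i hi => ?_)
  have hi := Nat.lt_succ_iff.1 (Finset.mem_range.1 hi)
  exact mul_nonneg (mul_pos (hc i) (hpos i hi)).le
    (add_nonneg (mul_nonneg (hpos t le_rfl).le (sum_krawtchouk_triple_nonneg hl _ _))
      (mul_nonneg (neg_pos.2 hneg).le (sum_krawtchouk_triple_nonneg hl _ _)))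

theorem lpCoeff_zero_pos (ht : t + 1 ≤ n) (hr₁ : smallestRoot n (t + 1) < (a : EReal))
    (hr₀ : (a : EReal) < smallestRoot n t) : 0 < lpCoeff n t a 0 := by
  obtain ⟨c, hc, h⟩ := exists_lpCoeff_eq (n := n) (t := t) (by omega) a
  have hneg := krawtchouk_succ_neg ht hr₁ hr₀
  have hpos : ∀ j ≤ t, 0 < krawtchouk n j a := fun j hj =>
    krawtchouk_pos_of_lt_smallestRoot (by omega) hr₀ hj le_rfl
  rw [h]
  -- The index i = t contributes the square K_t², whose zeroth coefficient is positive.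
  refine mul_pos (by positivity) (Finset.sum_pos' (fun i hi => ?_) ⟨t, by simp, ?_⟩)
  · have hi := Nat.lt_succ_iff.1 (Finset.mem_range.1 hi)
    exact mul_nonneg (mul_pos (hc i) (hpos i hi)).le
      (add_nonneg (mul_nonneg (hpos t le_rfl).le (sum_krawtchouk_triple_nonneg n.zero_le _ _))
        (mul_nonneg (neg_pos.2 hneg).le (sum_krawtchouk_triple_nonneg n.zero_le _ _)))
  · exact mul_pos (mul_pos (hc t) (hpos t le_rfl))
      (add_pos_of_nonneg_of_pos
        (mul_nonneg (hpos t le_rfl).le (sum_krawtchouk_triple_nonneg n.zero_le _ _))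
        (mul_pos (neg_pos.2 hneg) (sum_krawtchouk_sq_pos (by omega))))

theorem lpCoeff_weight (L : Fin n → Fin 4) :
    4 ^ n * lpCoeff n t a (weight L) = ∑ E, lpPoly n t a (weight E) * pauliChar E L := by
  rw [lpCoeff, sum_mul_krawtchouk_weight (fun x => lpPoly n t a x)]
  field_simp

end lpCoeff

end EAQuantum

/-! ### The MacWilliams identity and traces against the code projector -/

namespace EAQuantum

open scoped Kronecker ComplexOrder

/-- For h = I this is ∑ g⊗g = 2·SWAP; the signs arise on conjugating the first factor by h. -/
theorem sum_pauliSign_mul_pauli (h : Fin 4) (a b c d : Fin 2) :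
    ∑ g, (pauliSign g h : ℂ) * (pauli g a b * pauli g c d) = 2 * (pauli h a d * pauli h c b) := by
  fin_cases h <;> fin_cases a <;> fin_cases b <;> fin_cases c <;> fin_cases d <;>
    simp [Fin.sum_univ_four, pauliSign, pauli] <;> norm_num

theorem sum_pauliChar_mul_pauliString {n : ℕ} (H : Fin n → Fin 4) (u v w z : Fin n → Fin 2) :
    ∑ E, (pauliChar E H : ℂ) * (pauliString E u v * pauliString E w z)
      = 2 ^ n * (pauliString H u z * pauliString H w v) := by
  have h : ∀ E : Fin n → Fin 4,
      (pauliChar E H : ℂ) * (pauliString E u v * pauliString E w z)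
        = ∏ j, ((pauliSign (E j) (H j) : ℂ) *
          (pauli (E j) (u j) (v j) * pauli (E j) (w j) (z j))) := by
    intro E
    simp only [pauliChar, pauliString, Matrix.of_apply, Finset.prod_mul_distrib,
      Complex.ofReal_prod]
  simp_rw [h]
  rw [← Fintype.prod_sum (fun j g => (pauliSign g (H j) : ℂ) *
    (pauli g (u j) (v j) * pauli g (w j) (z j)))]
  simp_rw [sum_pauliSign_mul_pauli]
  simp only [pauliString, Matrix.of_apply, Finset.prod_mul_distrib, Finset.prod_const,
    Finset.card_univ, Fintype.card_fin]

theorem pauliChar_zero {n : ℕ} (E : Fin n → Fin 4) : pauliChar E 0 = 1 := by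
  simp [pauliChar, pauliSign]

theorem sum_pauliChar_mul_kronecker {n c : ℕ} (H : Fin n → Fin 4)
    (p q r s : (Fin n → Fin 2) × (Fin c → Fin 2)) :
    ∑ E : Fin n → Fin 4, ∑ F : Fin c → Fin 4, (pauliChar E H : ℂ) *
        ((pauliString E ⊗ₖ pauliString F) p q * (pauliString E ⊗ₖ pauliString F) r s)
      = 2 ^ (n + c) * ((pauliString H ⊗ₖ pauliString (0 : Fin c → Fin 4)) p s *
        (pauliString H ⊗ₖ pauliString (0 : Fin c → Fin 4)) r q) := by
  have hA := sum_pauliChar_mul_pauliString H p.1 q.1 r.1 s.1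
  have hB := sum_pauliChar_mul_pauliString (0 : Fin c → Fin 4) p.2 q.2 r.2 s.2
  simp only [pauliChar_zero, Complex.ofReal_one, one_mul] at hB
  simp only [Matrix.kroneckerMap_apply]
  calc _ = (∑ E, (pauliChar E H : ℂ) * (pauliString E p.1 q.1 * pauliString E r.1 s.1)) *
        ∑ F : Fin c → Fin 4, pauliString F p.2 q.2 * pauliString F r.2 s.2 := by
        rw [Finset.sum_mul_sum]
        exact Finset.sum_congr rfl fun E _ => Finset.sum_congr rfl fun F _ => by ring
    _ = _ := by rw [hA, hB]; ring

/-- Indexed with the same P-factor as in `trace_mul_mul_mul`, so that MacWilliams reduces to an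
identity between entries of Pauli strings, whatever P is. -/
theorem mul_trace_mul_sq {ι : Type*} [Fintype ι] (x : ℂ) (A P : Matrix ι ι ℂ) :
    x * (A * P).trace ^ 2 = ∑ i : (ι × ι) × (ι × ι),
      (x * (A i.1.1 i.1.2 * A i.2.1 i.2.2)) * (P i.1.2 i.1.1 * P i.2.2 i.2.1) := by
  have hT : (A * P).trace = ∑ i : ι × ι, A i.1 i.2 * P i.2 i.1 := by
    simp only [Matrix.trace, Matrix.diag_apply, Matrix.mul_apply, Fintype.sum_prod_type]
  rw [hT, pow_two, Fintype.sum_mul_sum, ← Fintype.sum_prod_type', Finset.mul_sum]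
  exact Finset.sum_congr rfl fun i _ => by ring

theorem trace_mul_mul_mul {ι : Type*} [Fintype ι] (A P : Matrix ι ι ℂ) :
    (A * (P * (A * P))).trace = ∑ i : (ι × ι) × (ι × ι),
      (A i.1.1 i.2.2 * A i.2.1 i.1.2) * (P i.1.2 i.1.1 * P i.2.2 i.2.1) := by
  simp only [Matrix.trace, Matrix.diag_apply, Matrix.mul_apply, Fintype.sum_prod_type,
    Finset.mul_sum]
  refine Finset.sum_congr rfl fun p _ => ?_
  rw [Finset.sum_comm, Finset.sum_congr rfl fun r _ => Finset.sum_comm, Finset.sum_comm]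
  exact Finset.sum_congr rfl fun q _ => Finset.sum_congr rfl fun r _ =>
    Finset.sum_congr rfl fun s _ => by ring

theorem sum_pauliChar_mul_trace_sq {n c : ℕ} (H : Fin n → Fin 4)
    (P : Matrix ((Fin n → Fin 2) × (Fin c → Fin 2)) ((Fin n → Fin 2) × (Fin c → Fin 2)) ℂ) :
    ∑ E : Fin n → Fin 4, ∑ F : Fin c → Fin 4, (pauliChar E H : ℂ) *
        ((pauliString E ⊗ₖ pauliString F) * P).trace ^ 2
      = 2 ^ (n + c) * ((pauliString H ⊗ₖ pauliString (0 : Fin c → Fin 4)) * (P *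
        ((pauliString H ⊗ₖ pauliString (0 : Fin c → Fin 4)) * P))).trace := by
  simp_rw [mul_trace_mul_sq]
  rw [trace_mul_mul_mul, Finset.sum_congr rfl fun E _ => Finset.sum_comm, Finset.sum_comm,
    Finset.mul_sum]
  refine Finset.sum_congr rfl fun i _ => ?_
  simp_rw [← Finset.sum_mul]
  rw [sum_pauliChar_mul_kronecker, mul_assoc]

theorem pauli_conjTranspose (g : Fin 4) (a b : Fin 2) : star (pauli g b a) = pauli g a b := by
  fin_cases g <;> fin_cases a <;> fin_cases b <;> simp [pauli]

theorem pauliString_isHermitian {n : ℕ} (E : Fin n → Fin 4) : (pauliString E).IsHermitian := by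
  ext u v
  simp only [Matrix.conjTranspose_apply, pauliString, Matrix.of_apply, star_prod,
    pauli_conjTranspose]

theorem pauliString_zero (n : ℕ) : pauliString (0 : Fin n → Fin 4) = 1 := by
  ext u v
  rw [pauliString, Matrix.of_apply, Matrix.one_apply]
  have h : ∀ a b : Fin 2, pauli 0 a b = if a = b then 1 else 0 := by
    intro a b
    fin_cases a <;> fin_cases b <;> simp [pauli]
  simp only [Pi.zero_apply, h, Finset.prod_ite_zero, Finset.prod_const_one, Finset.mem_univ,
    true_imp_iff, funext_iff]

theorem pauliKronecker_isHermitian {n c : ℕ} (E : Fin n → Fin 4) (F : Fin c → Fin 4) :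
    (pauliString E ⊗ₖ pauliString F).IsHermitian := by
  rw [Matrix.IsHermitian, Matrix.conjTranspose_kronecker, pauliString_isHermitian,
    pauliString_isHermitian]

section Projector

variable {ι : Type*} [Fintype ι] {A P : Matrix ι ι ℂ}

theorem trace_mul_eq_re (hA : A.IsHermitian) (hP : P.IsHermitian) :
    (A * P).trace = ((A * P).trace.re : ℂ) := by
  refine (Complex.conj_eq_iff_re.1 ?_).symm
  change star _ = _
  rw [← Matrix.trace_conjTranspose, Matrix.conjTranspose_mul, hA, hP, Matrix.trace_mul_comm]

theorem trace_mul_eq_trace_compress (hP : P * P = P) :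
    (A * P).trace = (P * A * P).trace := by
  rw [Matrix.trace_mul_comm (P * A), ← Matrix.mul_assoc, hP, Matrix.trace_mul_comm]

theorem trace_mul_mul_mul_eq_compress (hP : P * P = P) :
    (A * (P * (A * P))).trace = ((P * A * P) * (P * A * P)).trace := by
  have h : (P * A * P) * (P * A * P) = P * (A * (P * (A * P))) := by
    calc _ = P * A * (P * P) * A * P := by simp only [Matrix.mul_assoc]
      _ = _ := by rw [hP]; simp only [Matrix.mul_assoc]
  rw [h, Matrix.trace_mul_comm P]
  simp only [Matrix.mul_assoc, hP]

/-- The trace is Tr(X*X) for the Hermitian matrix X = PAP. -/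
theorem trace_mul_mul_mul_nonneg (hA : A.IsHermitian) (hP : P.IsHermitian) (hP2 : P * P = P) :
    0 ≤ (A * (P * (A * P))).trace := by
  have hX : (P * A * P).conjTranspose = P * A * P := by
    simp only [Matrix.conjTranspose_mul, hA.eq, hP.eq, Matrix.mul_assoc]
  rw [trace_mul_mul_mul_eq_compress hP2]
  nth_rw 1 [← hX]
  exact (Matrix.posSemidef_conjTranspose_mul_self _).trace_nonneg

/-- Both sides equal (λ Tr P)². -/
theorem trace_sq_eq_of_compress (hP : P * P = P) {lam : ℂ} (h : P * A * P = lam • P) :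
    P.trace * (A * (P * (A * P))).trace = (A * P).trace ^ 2 := by
  rw [trace_mul_mul_mul_eq_compress hP, trace_mul_eq_trace_compress hP, h]
  simp only [Matrix.smul_mul, Matrix.mul_smul, hP, Matrix.trace_smul, smul_eq_mul]
  ring

end Projector

section Code

variable {n c : ℕ}

/-- The matrix of the orthogonal projector onto `Q`. -/
noncomputable def projMatrix (Q : Submodule ℂ (StateSpace n c)) :
    Matrix ((Fin n → Fin 2) × (Fin c → Fin 2)) ((Fin n → Fin 2) × (Fin c → Fin 2)) ℂ :=
  Matrix.toEuclideanLin.symm (Q.starProjection : StateSpace n c →ₗ[ℂ] StateSpace n c)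

variable (Q : Submodule ℂ (StateSpace n c))

theorem toEuclideanLin_projMatrix :
    Matrix.toEuclideanLin (projMatrix Q)
      = (Q.starProjection : StateSpace n c →ₗ[ℂ] StateSpace n c) :=
  LinearEquiv.apply_symm_apply _ _

theorem projMatrix_isHermitian : (projMatrix Q).IsHermitian := by
  rw [← Matrix.isSymmetric_toEuclideanLin_iff, toEuclideanLin_projMatrix]
  exact Q.starProjection_isSymmetric

theorem projMatrix_mul_self : projMatrix Q * projMatrix Q = projMatrix Q := by
  apply Matrix.toEuclideanLin.injective
  rw [Matrix.toLpLin_mul_same, toEuclideanLin_projMatrix]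
  exact congrArg ContinuousLinearMap.toLinearMap Q.isIdempotentElem_starProjection.eq

theorem trace_toEuclideanLin {ι : Type*} [Fintype ι] [DecidableEq ι] (A : Matrix ι ι ℂ) :
    LinearMap.trace ℂ (EuclideanSpace ℂ ι) (Matrix.toEuclideanLin A) = A.trace := by
  rw [Matrix.toEuclideanLin, Matrix.toLpLin_eq_toLin, Matrix.trace_toLin_eq]

theorem trace_projMatrix : (projMatrix Q).trace = Module.finrank ℂ Q := by
  rw [← trace_toEuclideanLin, toEuclideanLin_projMatrix]
  refine LinearMap.IsProj.trace (p := Q) ⟨fun x => ?_, fun x hx => ?_⟩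
  · exact Q.starProjection_apply_mem x
  · exact Submodule.starProjection_eq_self_iff.2 hx

theorem trace_pauliOp_comp_starProjection (E : Fin n → Fin 4) (F : Fin c → Fin 4) :
    LinearMap.trace ℂ (StateSpace n c)
        (pauliOp E F ∘ₗ (Q.starProjection : StateSpace n c →ₗ[ℂ] StateSpace n c))
      = ((pauliString E ⊗ₖ pauliString F) * projMatrix Q).trace := by
  rw [← trace_toEuclideanLin, Matrix.toLpLin_mul_same, toEuclideanLin_projMatrix]
  rfl

theorem exists_compress_of_detectable {E : Fin n → Fin 4} {F : Fin c → Fin 4}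
    (h : Detectable Q (pauliOp E F)) :
    ∃ lam : ℂ, projMatrix Q * (pauliString E ⊗ₖ pauliString F) * projMatrix Q
      = lam • projMatrix Q := by
  obtain ⟨lam, h⟩ := h
  refine ⟨lam, Matrix.toEuclideanLin.injective ?_⟩
  rw [Matrix.toLpLin_mul_same, Matrix.toLpLin_mul_same, map_smul, toEuclideanLin_projMatrix]
  refine LinearMap.ext fun w => ext_inner_left ℂ fun v => ?_
  change inner ℂ v (Q.starProjection (pauliOp E F (Q.starProjection w)))
    = inner ℂ v (lam • Q.starProjection w)
  rw [← Q.inner_starProjection_left_eq_right, h _ (Q.starProjection_apply_mem v) _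
    (Q.starProjection_apply_mem w), inner_smul_right, Q.inner_starProjection_left_eq_right]
  congr 2
  exact Submodule.starProjection_eq_self_iff.2 (Q.starProjection_apply_mem w)

/-- The real number `Tr ((E ⊗ F) P)`. -/
noncomputable def pauliTrace (E : Fin n → Fin 4) (F : Fin c → Fin 4) : ℝ :=
  ((pauliString E ⊗ₖ pauliString F) * projMatrix Q).trace.re

/-- The real number `Tr ((E ⊗ I) P (E ⊗ I) P)`. -/
noncomputable def dualPauliTrace (E : Fin n → Fin 4) : ℝ :=
  ((pauliString E ⊗ₖ pauliString (0 : Fin c → Fin 4)) * (projMatrix Q *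
    ((pauliString E ⊗ₖ pauliString (0 : Fin c → Fin 4)) * projMatrix Q))).trace.re

theorem ofReal_pauliTrace (E : Fin n → Fin 4) (F : Fin c → Fin 4) :
    (pauliTrace Q E F : ℂ) = ((pauliString E ⊗ₖ pauliString F) * projMatrix Q).trace :=
  (trace_mul_eq_re (pauliKronecker_isHermitian E F) (projMatrix_isHermitian Q)).symm

theorem dualPauliTrace_nonneg (E : Fin n → Fin 4) : 0 ≤ dualPauliTrace Q E :=
  (Complex.nonneg_iff.1 (trace_mul_mul_mul_nonneg (pauliKronecker_isHermitian E 0)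
    (projMatrix_isHermitian Q) (projMatrix_mul_self Q))).1

theorem ofReal_dualPauliTrace (E : Fin n → Fin 4) :
    (dualPauliTrace Q E : ℂ) = ((pauliString E ⊗ₖ pauliString (0 : Fin c → Fin 4)) *
      (projMatrix Q *
        ((pauliString E ⊗ₖ pauliString (0 : Fin c → Fin 4)) * projMatrix Q))).trace :=
  Complex.ext rfl (Complex.nonneg_iff.1 (trace_mul_mul_mul_nonneg (pauliKronecker_isHermitian E 0)
    (projMatrix_isHermitian Q) (projMatrix_mul_self Q))).2

/-- The MacWilliams identity, summed over Bob's Pauli operators. -/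
theorem sum_pauliChar_mul_pauliTrace_sq (H : Fin n → Fin 4) :
    ∑ E : Fin n → Fin 4, pauliChar E H * ∑ F : Fin c → Fin 4, pauliTrace Q E F ^ 2
      = 2 ^ (n + c) * dualPauliTrace Q H := by
  have h := sum_pauliChar_mul_trace_sq H (projMatrix Q)
  simp_rw [← ofReal_pauliTrace, ← ofReal_dualPauliTrace, ← Finset.mul_sum] at h
  exact_mod_cast h

theorem finrank_mul_dualPauliTrace {E : Fin n → Fin 4}
    (h : Detectable Q (pauliOp E (0 : Fin c → Fin 4))) :
    Module.finrank ℂ Q * dualPauliTrace Q E = pauliTrace Q E 0 ^ 2 := by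
  obtain ⟨lam, h⟩ := exists_compress_of_detectable Q h
  have h := trace_sq_eq_of_compress (projMatrix_mul_self Q) h
  rw [trace_projMatrix, ← ofReal_pauliTrace, ← ofReal_dualPauliTrace] at h
  exact_mod_cast h

theorem pauliTrace_zero_zero :
    pauliTrace Q (0 : Fin n → Fin 4) (0 : Fin c → Fin 4) = Module.finrank ℂ Q := by
  rw [pauliTrace, pauliString_zero, pauliString_zero, Matrix.one_kronecker_one, Matrix.one_mul,
    trace_projMatrix, Complex.natCast_re]

theorem splitB_zero_right (i : ℕ) :
    splitB Q i 0 = 1 / (Module.finrank ℂ Q : ℝ) ^ 2 *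
      ∑ E ∈ Finset.univ.filter (fun E : Fin n → Fin 4 => weight E = i), pauliTrace Q E 0 ^ 2 := by
  rw [splitB]
  congr 1
  refine Finset.sum_congr rfl fun E _ => ?_
  simp only [weight_eq_zero_iff]
  rw [Finset.sum_filter, Finset.sum_ite_eq' _ _ _, if_pos (Finset.mem_univ _),
    trace_pauliOp_comp_starProjection, ← ofReal_pauliTrace, Complex.norm_real, Real.norm_eq_abs,
    sq_abs]

theorem pauliTrace_eq_zero_of_not_degenerate {d : ℕ} (hQ : ¬ Degenerate Q d)
    (hM : 0 < Module.finrank ℂ Q) {E : Fin n → Fin 4} (h0 : 0 < weight E) (hd : weight E < d) :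
    pauliTrace Q E (0 : Fin c → Fin 4) = 0 := by
  by_contra h
  refine hQ ⟨weight E, h0, hd, ?_⟩
  rw [splitB_zero_right]
  refine mul_pos (by positivity) (Finset.sum_pos' (fun _ _ => sq_nonneg _) ⟨E, by simp, ?_⟩)
  positivity

end Code

end EAQuantum

/-! ### The linear programming inequality -/

namespace EAQuantum

variable {n c t : ℕ} {a : ℝ}

theorem lpPoly_nonneg {x : ℝ} (hx : x ≤ a) : 0 ≤ lpPoly n t a x :=
  div_nonneg (sq_nonneg _) (sub_nonneg.2 hx)

theorem lpPoly_nonpos {x : ℝ} (hx : a ≤ x) : lpPoly n t a x ≤ 0 :=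
  div_nonpos_of_nonneg_of_nonpos (sq_nonneg _) (sub_nonpos.2 hx)

theorem lpPoly_zero (n t : ℕ) (a : ℝ) : lpPoly n t a 0 =
    (3 ^ (t + 1) * (n.choose (t + 1) : ℝ) * krawtchouk n t a
      - 3 ^ t * (n.choose t : ℝ) * krawtchouk n (t + 1) a) ^ 2 / a := by
  rw [lpPoly, krawtchouk_at_zero, krawtchouk_at_zero, sub_zero]

/-- MacWilliams weighted by F(wt H) and summed over H: by symmetry of the signs, the transform moves
from S to F. -/
theorem sum_lpCoeff_mul_pauliTrace (Q : Submodule ℂ (StateSpace n c)) :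
    4 ^ n * ∑ E : Fin n → Fin 4, lpCoeff n t a (weight E) *
        ∑ F : Fin c → Fin 4, pauliTrace Q E F ^ 2
      = 2 ^ (n + c) * ∑ H : Fin n → Fin 4, lpPoly n t a (weight H) * dualPauliTrace Q H := by
  simp only [Finset.mul_sum (a := (4 : ℝ) ^ n), Finset.mul_sum (a := (2 : ℝ) ^ (n + c)),
    ← mul_assoc, lpCoeff_weight]
  have h : ∀ H : Fin n → Fin 4, 2 ^ (n + c) * lpPoly n t a (weight H) * dualPauliTrace Q H
      = ∑ E : Fin n → Fin 4, lpPoly n t a (weight H) * pauliChar H E *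
        ∑ F : Fin c → Fin 4, pauliTrace Q E F ^ 2 := by
    intro H
    rw [mul_right_comm, ← sum_pauliChar_mul_pauliTrace_sq, Finset.sum_mul]
    refine Finset.sum_congr rfl fun E _ => ?_
    rw [pauliChar_comm H]
    ring
  simp only [h, Finset.sum_mul]
  rw [Finset.sum_comm]

/-- The linear programming inequality. -/
theorem lp_inequality {M d : ℕ} (ht : t + 1 ≤ n)
    (hr₁ : smallestRoot n (t + 1) < (a : EReal)) (hr₀ : (a : EReal) < smallestRoot n t)
    (had : a ≤ (d : ℝ)) {Q : Submodule ℂ (StateSpace n c)} (hQ : IsEACode n M d c Q) :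
    M * 4 ^ n * ∑ E ∈ Finset.univ.filter (fun E : Fin n → Fin 4 => weight E < d),
        lpCoeff n t a (weight E) * pauliTrace Q E 0 ^ 2
      ≤ 2 ^ (n + c) * ∑ E ∈ Finset.univ.filter (fun E : Fin n → Fin 4 => weight E < d),
        lpPoly n t a (weight E) * pauliTrace Q E 0 ^ 2 := by
  have hF : ∀ E : Fin n → Fin 4, 0 ≤ lpCoeff n t a (weight E) := fun E =>
    lpCoeff_nonneg ht hr₁ hr₀ (weight_le E)
  -- As F_l ≥ 0, dropping Bob's nonidentity operators and the weights ≥ d only lowers the sum.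
  have h1 : ∑ E ∈ Finset.univ.filter (fun E : Fin n → Fin 4 => weight E < d),
        lpCoeff n t a (weight E) * pauliTrace Q E 0 ^ 2
      ≤ ∑ E : Fin n → Fin 4, lpCoeff n t a (weight E) *
        ∑ F : Fin c → Fin 4, pauliTrace Q E F ^ 2 := by
    refine (Finset.sum_le_sum fun E _ => mul_le_mul_of_nonneg_left
      (Finset.single_le_sum (f := fun F : Fin c → Fin 4 => pauliTrace Q E F ^ 2)
        (fun F _ => sq_nonneg _) (Finset.mem_univ 0)) (hF E)).trans ?_
    exact Finset.sum_le_sum_of_subset_of_nonneg (Finset.filter_subset _ _) fun E _ _ =>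
      mul_nonneg (hF E) (Finset.sum_nonneg fun F _ => sq_nonneg _)
  -- Weights ≥ d ≥ a contribute nonpositive terms.
  have h2 : ∑ H : Fin n → Fin 4, lpPoly n t a (weight H) * dualPauliTrace Q H
      ≤ ∑ H ∈ Finset.univ.filter (fun E : Fin n → Fin 4 => weight E < d),
        lpPoly n t a (weight H) * dualPauliTrace Q H := by
    rw [← Finset.sum_filter_add_sum_filter_not Finset.univ
      (fun E : Fin n → Fin 4 => weight E < d), add_le_iff_nonpos_right]
    refine Finset.sum_nonpos fun H hH => mul_nonpos_of_nonpos_of_nonneg (lpPoly_nonpos ?_)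
      (dualPauliTrace_nonneg Q H)
    have hd : (d : ℝ) ≤ weight H := by
      exact_mod_cast not_lt.1 (Finset.mem_filter.1 hH).2
    linarith
  -- Errors of weight below d are detectable, which turns M·D(E) into T(E,I)².
  have h3 : M * ∑ H ∈ Finset.univ.filter (fun E : Fin n → Fin 4 => weight E < d),
        lpPoly n t a (weight H) * dualPauliTrace Q H
      = ∑ E ∈ Finset.univ.filter (fun E : Fin n → Fin 4 => weight E < d),
        lpPoly n t a (weight E) * pauliTrace Q E 0 ^ 2 := by
    rw [Finset.mul_sum]
    refine Finset.sum_congr rfl fun E hE => ?_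
    rw [← finrank_mul_dualPauliTrace Q (hQ.detects E (Finset.mem_filter.1 hE).2), hQ.dim]
    ring
  calc _ = M * (4 ^ n * ∑ E ∈ Finset.univ.filter (fun E : Fin n → Fin 4 => weight E < d),
        lpCoeff n t a (weight E) * pauliTrace Q E 0 ^ 2) := by ring
    _ ≤ M * (4 ^ n * ∑ E : Fin n → Fin 4, lpCoeff n t a (weight E) *
        ∑ F : Fin c → Fin 4, pauliTrace Q E F ^ 2) := by gcongr
    _ = M * (2 ^ (n + c) * ∑ H : Fin n → Fin 4,
        lpPoly n t a (weight H) * dualPauliTrace Q H) := by rw [sum_lpCoeff_mul_pauliTrace]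
    _ ≤ M * (2 ^ (n + c) * ∑ H ∈ Finset.univ.filter (fun E : Fin n → Fin 4 => weight E < d),
        lpPoly n t a (weight H) * dualPauliTrace Q H) := by gcongr
    _ = _ := by rw [mul_left_comm, h3]

theorem le_of_mul_four_pow_le {M s r : ℝ} (hs : 0 < s)
    (h : M * 4 ^ n * s ≤ 2 ^ (n + c) * (r * s)) :
    M ≤ 1 / (2 : ℝ) ^ ((n : ℤ) - (c : ℤ)) * r := by
  rw [← mul_assoc] at h
  have h := le_of_mul_le_mul_right h hs
  rw [zpow_sub₀ two_ne_zero, zpow_natCast, zpow_natCast, one_div_div, div_mul_eq_mul_div,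
    le_div_iff₀ (by positivity)]
  have h4 : (4 : ℝ) ^ n = 2 ^ n * 2 ^ n := by rw [← mul_pow]; norm_num
  rw [h4, pow_add] at h
  exact le_of_mul_le_mul_left (a := (2 : ℝ) ^ n) (by linarith) (by positivity)

end EAQuantum

/-! ### The two bounds -/

theorem mainTheorem5 (n M d c t : ℕ) (a : ℝ) (hd : 1 ≤ d) (ht : t + 1 ≤ n)
    (hr₁ : EAQuantum.smallestRoot n (t + 1) < (a : EReal))
    (hr₀ : (a : EReal) < EAQuantum.smallestRoot n t)
    (had : a ≤ (d : ℝ))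
    (Q : Submodule ℂ (EAQuantum.StateSpace n c)) (hQ : EAQuantum.IsEACode n M d c Q) :
    ((∀ l : ℕ, l < d → EAQuantum.lpCoeff n t a l ≠ 0) →
      (M : ℝ) ≤ 1 / (2 : ℝ) ^ ((n : ℤ) - (c : ℤ)) *
        (Finset.range d).sup' (Finset.nonempty_range_iff.mpr (Nat.one_le_iff_ne_zero.mp hd))
          (fun l : ℕ => EAQuantum.lpPoly n t a l / EAQuantum.lpCoeff n t a l)) ∧
    (¬ EAQuantum.Degenerate Q d →
      (M : ℝ) ≤ 1 / (2 : ℝ) ^ ((n : ℤ) - (c : ℤ)) *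
        ((3 ^ (t + 1) * (n.choose (t + 1) : ℝ) * EAQuantum.krawtchouk n t a
            - 3 ^ t * (n.choose t : ℝ) * EAQuantum.krawtchouk n (t + 1) a) ^ 2
          / (a * EAQuantum.lpCoeff n t a 0))) := by
  have ha : 0 < a := EAQuantum.pos_of_smallestRoot_lt ht hr₁
  have hF0 : 0 < EAQuantum.lpCoeff n t a 0 := EAQuantum.lpCoeff_zero_pos ht hr₁ hr₀
  have hlp := EAQuantum.lp_inequality ht hr₁ hr₀ had hQ
  have hw : EAQuantum.weight (0 : Fin n → Fin 4) = 0 := (EAQuantum.weight_eq_zero_iff _).2 rfl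
  have hmem : (0 : Fin n → Fin 4) ∈ Finset.univ.filter
      (fun E : Fin n → Fin 4 => EAQuantum.weight E < d) := by
    simpa [hw] using Nat.lt_of_lt_of_le Nat.zero_lt_one hd
  have hT : EAQuantum.pauliTrace Q (0 : Fin n → Fin 4) (0 : Fin c → Fin 4) = M := by
    rw [EAQuantum.pauliTrace_zero_zero, hQ.dim]
  have hP0 : 0 ≤ EAQuantum.lpPoly n t a 0 := EAQuantum.lpPoly_nonneg ha.le
  refine ⟨fun hne => ?_, fun hnd => ?_⟩
  · have hle : ∀ l < d, EAQuantum.lpPoly n t a l / EAQuantum.lpCoeff n t a l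
        ≤ (Finset.range d).sup' (Finset.nonempty_range_iff.mpr (Nat.one_le_iff_ne_zero.mp hd))
          (fun l : ℕ => EAQuantum.lpPoly n t a l / EAQuantum.lpCoeff n t a l) := fun l hl =>
      Finset.le_sup' (fun l : ℕ => EAQuantum.lpPoly n t a l / EAQuantum.lpCoeff n t a l)
        (Finset.mem_range.2 hl)
    set m := (Finset.range d).sup' (Finset.nonempty_range_iff.mpr (Nat.one_le_iff_ne_zero.mp hd))
      (fun l : ℕ => EAQuantum.lpPoly n t a l / EAQuantum.lpCoeff n t a l)
    -- For M = 0 all traces vanish and nothing can be cancelled; the bound holds because the ratio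
    -- at l = 0 is nonnegative.
    rcases Nat.eq_zero_or_pos M with rfl | hM
    · have hm : 0 ≤ m := by
        refine le_trans ?_ (hle 0 hd)
        rw [Nat.cast_zero]
        exact div_nonneg hP0 hF0.le
      rw [Nat.cast_zero]
      positivity
    · have hF : ∀ E : Fin n → Fin 4, 0 ≤ EAQuantum.lpCoeff n t a (EAQuantum.weight E) := fun E =>
        EAQuantum.lpCoeff_nonneg ht hr₁ hr₀ (EAQuantum.weight_le E)
      -- The sum to cancel is positive by its term E = I, where the trace is M. Termwise, F(l) ≤
      -- m·F_l.
      refine EAQuantum.le_of_mul_four_pow_le (Finset.sum_pos'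
        (fun E _ => mul_nonneg (hF E) (sq_nonneg _)) ⟨0, hmem, ?_⟩)
        (hlp.trans (mul_le_mul_of_nonneg_left ?_ (by positivity)))
      · rw [hw, hT]
        positivity
      · rw [Finset.mul_sum]
        refine Finset.sum_le_sum fun E hE => ?_
        have hEd := (Finset.mem_filter.1 hE).2
        rw [← mul_assoc]
        exact mul_le_mul_of_nonneg_right
          ((div_le_iff₀ (lt_of_le_of_ne (hF E) (hne _ hEd).symm)).1 (hle _ hEd)) (sq_nonneg _)
  · rw [← div_div, ← EAQuantum.lpPoly_zero]
    rcases Nat.eq_zero_or_pos M with rfl | hM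
    · rw [Nat.cast_zero]
      positivity
    -- Nondegeneracy removes every term of weight below d except E = I.
    · have hs : ∀ f : ℕ → ℝ, ∑ E ∈ Finset.univ.filter
          (fun E : Fin n → Fin 4 => EAQuantum.weight E < d),
            f (EAQuantum.weight E) * EAQuantum.pauliTrace Q E 0 ^ 2 = f 0 * (M : ℝ) ^ 2 := by
        intro f
        rw [Finset.sum_eq_single_of_mem 0 hmem, hw, hT]
        intro E hE hE0
        rw [EAQuantum.pauliTrace_eq_zero_of_not_degenerate Q hnd (hQ.dim.symm ▸ hM)
          (Nat.pos_of_ne_zero fun h => hE0 ((EAQuantum.weight_eq_zero_iff E).1 h))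
          (Finset.mem_filter.1 hE).2]
        ring
      rw [hs (EAQuantum.lpCoeff n t a), hs (fun l => EAQuantum.lpPoly n t a l)] at hlp
      refine EAQuantum.le_of_mul_four_pow_le (s := EAQuantum.lpCoeff n t a 0 * (M : ℝ) ^ 2)
        (by positivity) (hlp.trans_eq ?_)
      rw [Nat.cast_zero]
      field_simp
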